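/- Let $\mathcal X$ be a nonempty set and $\mathcal Y$ a finite set with $|\mathcal Y|\ge 2$. Let $T:\mathcal X\to\mathcal Y$ be a discrete memoryless channel given by transition probabilities $T(y|x)$, i.e. for every $x\in\mathcal X$ the column $T(\cdot|x)$ is a probability distribution on $\mathcal Y$. Let $\log$ be the natural logarithm, $0\log 0:=0$, and $\log^2 a:=(\log a)^2$. The Shannon capacity of $T$ (in nats) is the supremum of the mutual information between input and output over all discrete probability distributions $p$ on $\mathcal X$, $$C(T)=\sup_{p}\ \sum_{x\in\mathcal X}\sum_{y\in\mathcal Y}p(x)\,T(y|x)\,\log\frac{T(y|x)}{q_p(y)},\qquad q_p(y)=\sum_{x\in\mathcal X}p(x)\,T(y|x),$$ where terms with $p(x)T(y|x)=0$ are read as $0$. Let $S_{\max}$ and $S_{\min}$ denote the maximal and the minimal entropy $$S(T(\cdot|x))=-\sum_{y\in\mathcal Y}T(y|x)\log T(y|x)$$ of the columns $T(\cdot|x)$, $x\in\mathcal X$ (supremum and infimum, if $\mathcal X$ is infinite). Then $$C(T)\ \ge\ \frac{(S_{\max}-S_{\min})^2}{2\left(\log^2(|\mathcal Y|-1)+4\right)}-\frac{(S_{\max}-S_{\min})^3}{3\left(\log^2(|\mathcal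 Y|-1)+4\right)^2}.$$ -/

import Mathlib

namespace DMC

/-- Shannon entropy (in nats) of a probability distribution on a finite alphabet,
`S(P) = -∑ y, P y log (P y)`, with the convention `0 log 0 = 0`. -/
noncomputable def entropy {Y : Type*} [Fintype Y] (P : PMF Y) : ℝ :=
  -∑ y, (P y).toReal * Real.log (P y).toReal

/-- Mutual information (in nats) `I(X;Y)` between input and output of the discrete memoryless
channel with transition probabilities `T(y|x) = T x y`, when the input `X` has distribution `p`:
`∑ x, ∑ y, p(x) T(y|x) log (T(y|x) / q(y))`, where `q = p.bind T` is the distribution of the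
output. Terms with `p(x) T(y|x) = 0` vanish; `q(y) = 0` forces `p(x) T(y|x) = 0`. The outer series
always converges, see `summable_mutualInfo`. -/
noncomputable def mutualInfo {X Y : Type*} [Fintype Y] (T : X → PMF Y) (p : PMF X) : ℝ :=
  ∑' x, ∑ y, (p x).toReal * (T x y).toReal *
    Real.log ((T x y).toReal / (p.bind T y).toReal)

/-- Shannon capacity (in nats) of the discrete memoryless channel `T`: the supremum of the mutual
information over all input distributions. The supremum is over a bounded set, see
`bddAbove_mutualInfo`. -/
noncomputable def capacity {X Y : Type*} [Fintype Y] (T : X → PMF Y) : ℝ :=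
  ⨆ p : PMF X, mutualInfo T p

/-- The largest entropy of a column `T(·|x)`. -/
noncomputable def maxEntropy {X Y : Type*} [Fintype Y] (T : X → PMF Y) : ℝ :=
  ⨆ x, entropy (T x)

/-- The smallest entropy of a column `T(·|x)`. -/
noncomputable def minEntropy {X Y : Type*} [Fintype Y] (T : X → PMF Y) : ℝ :=
  ⨅ x, entropy (T x)

section WellDefined



theorem toReal_nonneg_le_one {α : Type*} (P : PMF α) (a : α) :
    0 ≤ (P a).toReal ∧ (P a).toReal ≤ 1 :=
  ⟨ENNReal.toReal_nonneg, ENNReal.toReal_le_of_le_ofReal zero_le_one (by simpa using P.coe_le_one a)⟩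

theorem sum_toReal {Y : Type*} [Fintype Y] (P : PMF Y) : ∑ y, (P y).toReal = 1 := by
  rw [← ENNReal.toReal_sum (fun y _ => P.apply_ne_top y), ← tsum_fintype (L := .unconditional Y),
    P.tsum_coe, ENNReal.toReal_one]

theorem entropy_nonneg {Y : Type*} [Fintype Y] (P : PMF Y) : 0 ≤ entropy P := by
  unfold entropy
  rw [neg_nonneg]
  exact Finset.sum_nonpos fun y _ => Real.mul_log_nonpos
    (toReal_nonneg_le_one P y).1 (toReal_nonneg_le_one P y).2

theorem entropy_le_card {Y : Type*} [Fintype Y] (P : PMF Y) : entropy P ≤ Fintype.card Y := by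
  have h : ∀ y, -((P y).toReal * Real.log (P y).toReal) ≤ 1 := by
    intro y
    have h0 := (toReal_nonneg_le_one P y).1
    rcases h0.eq_or_lt with h | h
    · simp [← h]
    · have := Real.one_sub_inv_le_log_of_pos h
      have h2 := mul_le_mul_of_nonneg_left this h0
      have h3 : (P y).toReal * (1 - (P y).toReal⁻¹) = (P y).toReal - 1 := by
        field_simp
      linarith
  unfold entropy
  rw [← Finset.sum_neg_distrib]
  calc _ ≤ ∑ _y : Y, (1 : ℝ) := Finset.sum_le_sum fun y _ => h y
    _ = Fintype.card Y := by simp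

theorem bddAbove_entropy {X Y : Type*} [Fintype Y] (T : X → PMF Y) : BddAbove (Set.range fun x => entropy (T x)) :=
  ⟨Fintype.card Y, by rintro _ ⟨x, rfl⟩; exact entropy_le_card _⟩

theorem bddBelow_entropy {X Y : Type*} [Fintype Y] (T : X → PMF Y) : BddBelow (Set.range fun x => entropy (T x)) :=
  ⟨0, by rintro _ ⟨x, rfl⟩; exact entropy_nonneg _⟩

theorem hasSum_bind {X Y : Type*} (T : X → PMF Y) (p : PMF X) (y : Y) :
    HasSum (fun x => (p x).toReal * (T x y).toReal) (p.bind T y).toReal := by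
  have h : (p.bind T y) = ∑' x, p x * T x y := PMF.bind_apply _ _ _
  have hne : ∑' x, p x * T x y ≠ ⊤ := h ▸ PMF.apply_ne_top _ _
  have := ENNReal.hasSum_toReal hne
  simp only [ENNReal.toReal_mul] at this
  rw [h, ENNReal.tsum_toReal_eq (fun x => ENNReal.ne_top_of_tsum_ne_top hne x)]
  simpa using this

theorem mutualInfo_term_bounds {X Y : Type*} [Fintype Y] (T : X → PMF Y) (p : PMF X) (x : X) :
    0 ≤ ∑ y, (p x).toReal * (T x y).toReal *
        Real.log ((T x y).toReal / (p.bind T y).toReal) ∧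
    ∑ y, (p x).toReal * (T x y).toReal *
        Real.log ((T x y).toReal / (p.bind T y).toReal) ≤
      ∑ y, (p x).toReal * (T x y).toReal * (-Real.log (p.bind T y).toReal) := by
  have hp := (toReal_nonneg_le_one p x).1
  have key : ∀ y, (p x).toReal * ((T x y).toReal - (p.bind T y).toReal) ≤
      (p x).toReal * (T x y).toReal * Real.log ((T x y).toReal / (p.bind T y).toReal) ∧
      (p x).toReal * (T x y).toReal * Real.log ((T x y).toReal / (p.bind T y).toReal) ≤
      (p x).toReal * (T x y).toReal * (-Real.log (p.bind T y).toReal) := by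
    intro y
    have ht := toReal_nonneg_le_one (T x) y
    have hq := (toReal_nonneg_le_one (p.bind T) y).1
    have hle : (p x).toReal * (T x y).toReal ≤ (p.bind T y).toReal :=
      le_hasSum (hasSum_bind T p y) x fun x' _ =>
        mul_nonneg ENNReal.toReal_nonneg ENNReal.toReal_nonneg
    set a := (p x).toReal
    set t := (T x y).toReal
    set q := (p.bind T y).toReal
    rcases hp.eq_or_lt with h | ha
    · simp [← h]
    rcases ht.1.eq_or_lt with h | h
    · simp only [← h, mul_zero, zero_mul, le_refl, and_true, zero_sub]
      nlinarith
    have hq' : 0 < q := lt_of_lt_of_le (mul_pos ha h) hle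
    constructor
    · have h1 := Real.one_sub_inv_le_log_of_pos (div_pos h hq')
      have h2 := mul_le_mul_of_nonneg_left h1 (mul_pos ha h).le
      have h3 : a * t * (1 - (t / q)⁻¹) = a * (t - q) := by field_simp
      linarith
    · apply mul_le_mul_of_nonneg_left _ (mul_pos ha h).le
      rw [Real.log_div h.ne' hq'.ne']
      have := Real.log_nonpos h.le ht.2
      linarith
  refine ⟨?_, Finset.sum_le_sum fun y _ => (key y).2⟩
  calc (0 : ℝ) = ∑ y, (p x).toReal * ((T x y).toReal - (p.bind T y).toReal) := by
        rw [← Finset.mul_sum, Finset.sum_sub_distrib, sum_toReal, sum_toReal]; simp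
    _ ≤ _ := Finset.sum_le_sum fun y _ => (key y).1

theorem hasSum_cross {X Y : Type*} [Fintype Y] (T : X → PMF Y) (p : PMF X) :
    HasSum (fun x => ∑ y, (p x).toReal * (T x y).toReal * (-Real.log (p.bind T y).toReal))
      (entropy (p.bind T)) := by
  have : entropy (p.bind T) =
      ∑ y, (p.bind T y).toReal * (-Real.log (p.bind T y).toReal) := by
    simp [entropy]
  rw [this]
  exact hasSum_sum fun y _ => (hasSum_bind T p y).mul_right _

theorem summable_mutualInfo {X Y : Type*} [Fintype Y] (T : X → PMF Y) (p : PMF X) :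
    Summable fun x => ∑ y, (p x).toReal * (T x y).toReal *
      Real.log ((T x y).toReal / (p.bind T y).toReal) :=
  Summable.of_nonneg_of_le (fun x => (mutualInfo_term_bounds T p x).1)
    (fun x => (mutualInfo_term_bounds T p x).2) (hasSum_cross T p).summable

theorem bddAbove_mutualInfo {X Y : Type*} [Fintype Y] (T : X → PMF Y) :
    BddAbove (Set.range fun p : PMF X => mutualInfo T p) := by
  refine ⟨Fintype.card Y, ?_⟩
  rintro _ ⟨p, rfl⟩
  refine le_trans ?_ (entropy_le_card (p.bind T))
  exact hasSum_le (fun x => (mutualInfo_term_bounds T p x).2)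
    (summable_mutualInfo T p).hasSum (hasSum_cross T p)

end WellDefined

end DMC

/-! Inputs mixing only two letters already give the bound. For columns `ρ`, `σ` with entropy gap
`Δ`, the weight maximizing the mutual information makes the output `q` equally far, in relative
entropy, from both columns, so the mutual information equals either distance
(`DMC.exists_mixture_relEntropy_eq`). The entropy of `q` differs from that of one column by at least
`Δ / 2`, so it remains to bound relative entropy below by an entropy difference.

That bound (`DMC.relEntropy_ge`) comes from the tilted family `q ^ u / Z u`: the second derivative
of `log Z` is the surprisal variance of the tilted distribution divided by `u ^ 2`. A uniform
variance bound `N = 1 + log (|Y| - 1) ^ 2 / 4` (`DMC.surprisalVariance_le`) thus controls `log Z`,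
and Gibbs' inequality turns this into `D(p‖q) ≥ N (exp x - 1 - x)` with `x` the entropy difference
over `N`. A cubic estimate of `exp` finishes. -/

/-! ### Maximal variance of the surprisal -/

open Real Finset in
/-- The variance of a two-valued surprisal. -/
theorem DMC.mul_log_ratio_sq_le (r L : ℝ) (h0 : 0 < r) (h1 : r < 1) :
    r * (1 - r) * (L + log (r / (1 - r))) ^ 2 ≤ 1 + L ^ 2 / 4 := by
  set x := log (r / (1 - r)) with hx
  have h1' : 0 < 1 - r := by linarith
  have hcosh : cosh (x / 2) ^ 2 * (4 * (r * (1 - r))) = 1 := by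
    have h2 : cosh (x / 2) ^ 2 = (cosh x + 1) / 2 := by
      have := cosh_two_mul (x / 2)
      have h3 := cosh_sq (x / 2)
      rw [mul_div_cancel₀ x two_ne_zero] at this
      linarith
    rw [h2, cosh_eq, exp_neg, hx, exp_log (div_pos h0 h1')]
    field_simp
    ring
  have hc : 1 + (x / 2) ^ 2 ≤ cosh (x / 2) ^ 2 := by
    rw [cosh_sq]
    have : (x / 2) ^ 2 ≤ sinh (x / 2) ^ 2 := by
      rw [sq_le_sq]
      rcases le_total 0 (x / 2) with h | h
      · have := self_le_sinh_iff.2 h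
        rwa [abs_of_nonneg h, abs_of_nonneg (h.trans this)]
      · have := sinh_le_self_iff.2 h
        rw [abs_of_nonpos h, abs_of_nonpos (this.trans h)]
        linarith
    linarith
  have hr : 0 < r * (1 - r) := mul_pos h0 h1'
  -- Cauchy–Schwarz for the vectors `(L, 2)` and `(1, x / 2)`.
  have hcs : (L + x) ^ 2 ≤ (L ^ 2 + 4) * (1 + (x / 2) ^ 2) := by
    nlinarith [sq_nonneg (L * x / 2 - 2)]
  calc r * (1 - r) * (L + x) ^ 2
      ≤ r * (1 - r) * ((L ^ 2 + 4) * cosh (x / 2) ^ 2) := by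
        refine mul_le_mul_of_nonneg_left (hcs.trans ?_) hr.le
        exact mul_le_mul_of_nonneg_left hc (by positivity)
    _ = (cosh (x / 2) ^ 2 * (4 * (r * (1 - r)))) * (1 + L ^ 2 / 4) := by ring
    _ = 1 + L ^ 2 / 4 := by rw [hcosh, one_mul]

-- Source of `|Y| - 1`: two nonempty disjoint classes of letters have size ratio at most `d - 1`.
open Real Finset in
theorem DMC.abs_log_div_le {n m d : ℕ} (hn : 0 < n) (hm : 0 < m) (h : n + m ≤ d) :
    |log ((m : ℝ) / n)| ≤ log ((d : ℝ) - 1) := by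
  have hn' : (1 : ℝ) ≤ n := by exact_mod_cast hn
  have hm' : (1 : ℝ) ≤ m := by exact_mod_cast hm
  have h' : (n : ℝ) + m ≤ d := by exact_mod_cast h
  have key : ∀ a b : ℝ, 1 ≤ a → 1 ≤ b → a + b ≤ d → log (a / b) ≤ log ((d : ℝ) - 1) := by
    intro a b ha hb hab
    refine log_le_log (by positivity) ?_
    rw [div_le_iff₀ (by linarith)]
    nlinarith
  rw [abs_le]
  refine ⟨?_, key _ _ hm' hn' (by linarith)⟩
  rw [neg_le, ← log_inv, inv_div]
  exact key _ _ hn' hm' h'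

open Real in
/-- The variance of the surprisal `-log p`. -/
noncomputable def DMC.surprisalVariance {Y : Type*} [Fintype Y] (p : Y → ℝ) : ℝ :=
  ∑ y, p y * log (p y) ^ 2 - (∑ y, p y * log (p y)) ^ 2

open Real Finset in
/-- A distribution whose positive probabilities take only two values. -/
theorem DMC.surprisalVariance_le_of_two_values {Y : Type*} [Fintype Y] (p : Y → ℝ)
    (hp : p ∈ stdSimplex ℝ Y) {a b : ℝ} (hab : a ≠ b) (ha : 0 < a) (hb : 0 < b)
    {i j : Y} (hi : p i = a) (hj : p j = b) (h : ∀ y, p y = 0 ∨ p y = a ∨ p y = b) :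
    DMC.surprisalVariance p ≤ 1 + log ((Fintype.card Y : ℝ) - 1) ^ 2 / 4 := by
  classical
  set A := univ.filter fun y => p y = a with hA
  set B := univ.filter fun y => p y = b with hB
  have hsum : ∀ f : ℝ → ℝ, f 0 = 0 → ∑ y, f (p y) = #A * f a + #B * f b := by
    intro f hf
    have : ∀ y, f (p y) = (if p y = a then f a else 0) + (if p y = b then f b else 0) := by
      intro y
      rcases h y with h | h | h
      · simp [h, hf, ha.ne, hb.ne]
      · simp [h, hab]
      · simp [h, hab.symm]
    simp only [this, sum_add_distrib, ← sum_filter, sum_const, nsmul_eq_mul, ← hA, ← hB]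
  have hn : 0 < #A := card_pos.2 ⟨i, by simp [hA, hi]⟩
  have hm : 0 < #B := card_pos.2 ⟨j, by simp [hB, hj]⟩
  have hnm : #A + #B ≤ Fintype.card Y := by
    rw [← card_union_of_disjoint, ← card_univ]
    · exact card_le_card (subset_univ _)
    · rw [Finset.disjoint_left]
      intro y hy hy'
      simp only [hA, hB, mem_filter] at hy hy'
      exact hab (hy.2.symm.trans hy'.2)
  have h1 : #A * a + #B * b = (1 : ℝ) := by
    rw [← hp.2]; exact (hsum id rfl).symm
  have h2 := hsum (fun x => x * log x ^ 2) (by simp)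
  have h3 := hsum (fun x => x * log x) (by simp)
  have hlog := DMC.abs_log_div_le hn hm hnm
  have hn' : (0 : ℝ) < #A := by exact_mod_cast hn
  have hm' : (0 : ℝ) < #B := by exact_mod_cast hm
  set n : ℝ := (#A : ℝ)
  set m : ℝ := (#B : ℝ)
  have hr0 : 0 < n * a := by positivity
  have hr1 : 0 < m * b := by positivity
  -- Here `r = n * a` is the total mass of the class `A`.
  have key := DMC.mul_log_ratio_sq_le (n * a) (log (m / n)) hr0 (by linarith)
  have hmb : 1 - n * a = m * b := by linarith
  have hl : log (m / n) + log (n * a / (1 - n * a)) = log a - log b := by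
    rw [hmb, log_div hm'.ne' hn'.ne', log_div hr0.ne' hr1.ne', log_mul hn'.ne' ha.ne',
      log_mul hm'.ne' hb.ne']
    ring
  rw [hl, hmb] at key
  have hsq : log (m / n) ^ 2 ≤ log ((Fintype.card Y : ℝ) - 1) ^ 2 :=
    sq_le_sq' (neg_le_of_abs_le hlog) (le_of_abs_le hlog)
  unfold DMC.surprisalVariance
  rw [h2, h3]
  have : n * (a * log a ^ 2) + m * (b * log b ^ 2) - (n * (a * log a) + m * (b * log b)) ^ 2
      = n * a * (m * b) * (log a - log b) ^ 2 := by
    have e : m * b = 1 - n * a := by linarith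
    calc _ = n * a * log a ^ 2 + (m * b) * log b ^ 2
          - (n * a * log a + (m * b) * log b) ^ 2 := by ring
      _ = _ := by rw [e]; ring
  linarith

open Real Finset in
theorem DMC.continuousOn_mul_log_sq : ContinuousOn (fun x : ℝ => x * log x ^ 2) (Set.Ici 0) := by
  have h : Continuous fun x : ℝ => 4 * (√x * log √x) ^ 2 := by
    have := continuous_mul_log.comp continuous_sqrt
    exact continuous_const.mul (this.pow 2)
  refine h.continuousOn.congr fun x hx => ?_
  simp only
  rw [log_sqrt hx, mul_pow, sq_sqrt hx]
  ring

open Real Finset in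
theorem DMC.continuousOn_surprisalVariance {Y : Type*} [Fintype Y] :
    ContinuousOn (DMC.surprisalVariance (Y := Y)) (stdSimplex ℝ Y) := by
  unfold DMC.surprisalVariance
  refine ContinuousOn.sub ?_ ?_
  · refine continuousOn_finsetSum _ fun y _ => ?_
    exact DMC.continuousOn_mul_log_sq.comp (continuous_apply y).continuousOn fun p hp => hp.1 y
  · refine Continuous.continuousOn (Continuous.pow (continuous_finsetSum _ fun y _ => ?_) 2)
    exact continuous_mul_log.comp (continuous_apply y)

-- Only letters of positive mass move, so the derivative exists even on the boundary of the simplex.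
open Real Finset in
theorem DMC.hasDerivAt_surprisalVariance {Y : Type*} [Fintype Y] (p c : Y → ℝ)
    (h : ∀ y, c y ≠ 0 → 0 < p y) :
    HasDerivAt (fun t : ℝ => DMC.surprisalVariance fun y => p y + t * c y)
      (∑ y, c y * (log (p y) ^ 2 + 2 * log (p y)
        - 2 * (∑ z, p z * log (p z)) * (log (p y) + 1))) 0 := by
  have hlin : ∀ y, HasDerivAt (fun t : ℝ => p y + t * c y) (c y) 0 := fun y => by
    simpa using ((hasDerivAt_id (0 : ℝ)).mul_const (c y)).const_add (p y)
  have h1 : ∀ y, HasDerivAt (fun t : ℝ => (p y + t * c y) * log (p y + t * c y) ^ 2)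
      (c y * (log (p y) ^ 2 + 2 * log (p y))) 0 := by
    intro y
    by_cases hc : c y = 0
    · simp only [hc, mul_zero, add_zero, zero_mul]
      exact hasDerivAt_const _ _
    · have hpy := h y hc
      have hne : p y + 0 * c y ≠ 0 := by simpa using hpy.ne'
      refine ((hlin y).fun_mul (((hlin y).log hne).fun_pow 2)).congr_deriv ?_
      simp only [zero_mul, add_zero, Nat.cast_ofNat, Nat.reduceSub, pow_one]
      field_simp
  have h2 : ∀ y, HasDerivAt (fun t : ℝ => (p y + t * c y) * log (p y + t * c y))
      (c y * (log (p y) + 1)) 0 := by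
    intro y
    by_cases hc : c y = 0
    · simp only [hc, mul_zero, add_zero, zero_mul]
      exact hasDerivAt_const _ _
    · have hpy := h y hc
      have hne : p y + 0 * c y ≠ 0 := by simpa using hpy.ne'
      refine ((hlin y).fun_mul ((hlin y).log hne)).congr_deriv ?_
      simp only [zero_mul, add_zero]
      field_simp
  refine ((HasDerivAt.fun_sum (u := univ) fun y _ => h1 y).fun_sub
    ((HasDerivAt.fun_sum (u := univ) fun y _ => h2 y).fun_pow 2)).congr_deriv ?_
  simp only [zero_mul, add_zero, Nat.cast_ofNat, Nat.reduceSub, pow_one]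
  rw [mul_sum univ (fun y => c y * (log (p y) + 1)), ← sum_sub_distrib]
  exact sum_congr rfl fun y _ => by ring

-- At a maximizer, moving mass between two letters of the support is stationary. Hence all `log (q
-- y)` on the support give one quadratic polynomial the same value, and at most two values occur.
open Real Finset in
theorem DMC.surprisalVariance_le {Y : Type*} [Fintype Y] (p : Y → ℝ)
    (hp : p ∈ stdSimplex ℝ Y) :
    DMC.surprisalVariance p ≤ 1 + log ((Fintype.card Y : ℝ) - 1) ^ 2 / 4 := by
  classical
  obtain ⟨q, hq, hmax⟩ := (isCompact_stdSimplex ℝ Y).exists_isMaxOn ⟨p, hp⟩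
    DMC.continuousOn_surprisalVariance
  refine le_trans (hmax hp) ?_
  obtain ⟨i, hi⟩ : ∃ i, 0 < q i := by
    by_contra! hcon
    have : ∑ y, q y ≤ 0 := sum_nonpos fun y _ => hcon y
    linarith [hq.2]
  set M := ∑ z, q z * log (q z) with hM
  have hstat : ∀ j k, j ≠ k → 0 < q j → 0 < q k →
      log (q j) ^ 2 + 2 * log (q j) - 2 * M * (log (q j) + 1)
        = log (q k) ^ 2 + 2 * log (q k) - 2 * M * (log (q k) + 1) := by
    intro j k hjk hj hk
    set c : Y → ℝ := Pi.single j 1 - Pi.single k 1 with hc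
    have hcj : c j = 1 := by simp [hc, hjk]
    have hck : c k = -1 := by simp [hc, hjk.symm]
    have hco : ∀ y, y ≠ j → y ≠ k → c y = 0 := fun y h1 h2 => by simp [hc, h1, h2]
    have hder := DMC.hasDerivAt_surprisalVariance q c (fun y hy => by
      by_cases h1 : y = j
      · rwa [h1]
      by_cases h2 : y = k
      · rwa [h2]
      exact absurd (hco y h1 h2) hy)
    have hloc : IsLocalMax (fun t : ℝ => DMC.surprisalVariance fun y => q y + t * c y) 0 := by
      have hnhds : Set.Icc (-q j) (q k) ∈ nhds (0 : ℝ) := Icc_mem_nhds (by linarith) hk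
      filter_upwards [hnhds] with t ht
      have hmem : (fun y => q y + t * c y) ∈ stdSimplex ℝ Y := by
        refine ⟨fun y => ?_, ?_⟩
        · by_cases h1 : y = j
          · subst h1; simp only [hcj]; linarith [ht.1]
          by_cases h2 : y = k
          · subst h2; simp only [hck]; linarith [ht.2]
          · simp only [hco y h1 h2, mul_zero, add_zero]; exact hq.1 y
        · rw [sum_add_distrib, ← mul_sum, hq.2]
          simp [hc]
      simpa using hmax hmem
    have h0 := hloc.hasDerivAt_eq_zero hder
    rw [← hM] at h0
    simp only [hc, Pi.sub_apply, sub_mul _ (Pi.single (M := fun _ => ℝ) k 1 _),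
      sum_sub_distrib] at h0
    simp only [Pi.single_apply, ite_mul, one_mul, zero_mul, sum_ite_eq', mem_univ, if_true] at h0
    linarith
  by_cases hall : ∀ j, 0 < q j → q j = q i
  · have hval : ∀ f : ℝ → ℝ, ∑ y, q y * f (q y) = f (q i) := by
      intro f
      have : ∀ y, q y * f (q y) = q y * f (q i) := by
        intro y
        rcases (hq.1 y).eq_or_lt with h | h
        · simp [← h]
        · rw [hall y h]
      simp only [this, ← sum_mul, hq.2, one_mul]
    unfold DMC.surprisalVariance
    rw [hval fun x => log x ^ 2, hval log]
    have := sq_nonneg (log ((Fintype.card Y : ℝ) - 1))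
    linarith
  · push Not at hall
    obtain ⟨j, hj, hji⟩ := hall
    have hij : i ≠ j := fun h => hji (by rw [h])
    refine DMC.surprisalVariance_le_of_two_values q hq hji.symm hi hj rfl rfl fun k => ?_
    rcases (hq.1 k).eq_or_lt with h | hk
    · exact Or.inl h.symm
    right
    by_contra! hcon
    have hki : i ≠ k := fun h => hcon.1 (by rw [h])
    have e1 := hstat i j hij hi hj
    have e2 := hstat i k hki hi hk
    have n1 : log (q i) - log (q j) ≠ 0 :=
      sub_ne_zero.2 fun h => hji (log_injOn_pos hi hj h).symm
    have n2 : log (q i) - log (q k) ≠ 0 :=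
      sub_ne_zero.2 fun h => hcon.1 (log_injOn_pos hi hk h).symm
    have n3 : log (q j) - log (q k) ≠ 0 :=
      sub_ne_zero.2 fun h => hcon.2 (log_injOn_pos hj hk h).symm
    -- Vieta: two distinct roots have sum `2 * M - 2`, so a third value would coincide with the
    -- second.
    have f1 : log (q i) + log (q j) + 2 - 2 * M = 0 :=
      (mul_eq_zero.1 (show (log (q i) - log (q j)) * (log (q i) + log (q j) + 2 - 2 * M) = 0 by
        linear_combination e1)).resolve_left n1
    have f2 : log (q i) + log (q k) + 2 - 2 * M = 0 :=
      (mul_eq_zero.1 (show (log (q i) - log (q k)) * (log (q i) + log (q k) + 2 - 2 * M) = 0 by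
        linear_combination e2)).resolve_left n2
    exact n3 (by linarith)
-- Tilting and the relative entropy bound
open Real Finset in
/-- The logarithm of the partition function of the tilted family `q ^ u`, bounded by means of a
bound `N` on the variance of the surprisal. -/
theorem DMC.log_partition_le {Y : Type*} [Fintype Y] (q : Y → ℝ) (hq : q ∈ stdSimplex ℝ Y)
    (N : ℝ) (hN : ∀ p ∈ stdSimplex ℝ Y, DMC.surprisalVariance p ≤ N) (u : ℝ) (hu : 0 < u) :
    log (∑ y, q y * exp ((u - 1) * log (q y))) ≤
      (∑ y, q y * log (q y)) * (u - 1) + N * (u - 1 - log u) := by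
  set Z : ℝ → ℝ := fun u => ∑ y, q y * exp ((u - 1) * log (q y)) with hZ
  set Z1 : ℝ → ℝ := fun u => ∑ y, q y * log (q y) * exp ((u - 1) * log (q y)) with hZ1
  set Z2 : ℝ → ℝ := fun u => ∑ y, q y * log (q y) ^ 2 * exp ((u - 1) * log (q y)) with hZ2
  have hexp : ∀ y u, HasDerivAt (fun u => exp ((u - 1) * log (q y)))
      (exp ((u - 1) * log (q y)) * log (q y)) u := fun y u => by
    simpa using (((hasDerivAt_id u).sub_const 1).mul_const (log (q y))).exp
  have dZ : ∀ u, HasDerivAt Z (Z1 u) u := fun u => by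
    refine (HasDerivAt.fun_sum (u := univ) fun y (_ : y ∈ univ) =>
      (hexp y u).const_mul (q y)).congr_deriv ?_
    exact sum_congr rfl fun y _ => by ring
  have dZ1 : ∀ u, HasDerivAt Z1 (Z2 u) u := fun u => by
    refine (HasDerivAt.fun_sum (u := univ) fun y (_ : y ∈ univ) =>
      (hexp y u).const_mul (q y * log (q y))).congr_deriv ?_
    exact sum_congr rfl fun y _ => by ring
  have hZpos : ∀ u, 0 < Z u := by
    intro u
    obtain ⟨i, hi⟩ : ∃ i, 0 < q i := by
      by_contra! hcon
      have : ∑ y, q y ≤ 0 := sum_nonpos fun y _ => hcon y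
      linarith [hq.2]
    exact sum_pos' (fun y _ => mul_nonneg (hq.1 y) (exp_pos _).le)
      ⟨i, mem_univ _, mul_pos hi (exp_pos _)⟩
  -- On the support `log τ = u * log q - log Z`, so the surprisal variance of `τ` is `u ^ 2` times
  -- the variance of `log q` under `τ`, which is `(log Z)''`.
  have hvar : ∀ u, u ^ 2 * (Z2 u / Z u - (Z1 u / Z u) ^ 2) ≤ N := by
    intro u
    set τ : Y → ℝ := fun y => q y * exp ((u - 1) * log (q y)) / Z u with hτ
    have hτs : ∑ y, τ y = 1 := by
      rw [hτ, ← sum_div]; exact div_self (hZpos u).ne'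
    have hmem : τ ∈ stdSimplex ℝ Y :=
      ⟨fun y => div_nonneg (mul_nonneg (hq.1 y) (exp_pos _).le) (hZpos u).le, hτs⟩
    have hlog : ∀ y, q y ≠ 0 → log (τ y) = u * log (q y) - log (Z u) := by
      intro y hy
      rw [hτ]
      simp only
      rw [log_div (mul_ne_zero hy (exp_pos _).ne') (hZpos u).ne', log_mul hy (exp_pos _).ne',
        log_exp]
      ring
    have hE : ∀ f : ℝ → ℝ, ∑ y, τ y * f (log (τ y)) =
        ∑ y, τ y * f (u * log (q y) - log (Z u)) := by
      intro f
      refine sum_congr rfl fun y _ => ?_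
      by_cases hy : q y = 0
      · simp [hτ, hy]
      · rw [hlog y hy]
    have e1 : Z1 u / Z u = ∑ y, τ y * log (q y) := by
      rw [hZ1, sum_div]
      exact sum_congr rfl fun y _ => by rw [hτ]; ring
    have e2 : Z2 u / Z u = ∑ y, τ y * log (q y) ^ 2 := by
      rw [hZ2, sum_div]
      exact sum_congr rfl fun y _ => by rw [hτ]; ring
    have key := hN τ hmem
    unfold DMC.surprisalVariance at key
    have k1 := hE fun x => x ^ 2
    have k2 := hE fun x => x
    rw [k1, k2] at key
    have k3 : ∑ y, τ y * (u * log (q y) - log (Z u)) ^ 2 =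
        u ^ 2 * (Z2 u / Z u) - 2 * u * log (Z u) * (Z1 u / Z u) + log (Z u) ^ 2 := by
      calc _ = ∑ y, (u ^ 2 * (τ y * log (q y) ^ 2) - 2 * u * log (Z u) * (τ y * log (q y))
            + log (Z u) ^ 2 * τ y) := sum_congr rfl fun y _ => by ring
        _ = _ := by
          rw [sum_add_distrib, sum_sub_distrib, ← mul_sum, ← mul_sum, ← mul_sum, hτs, e1, e2,
            mul_one]
    have k4 : ∑ y, τ y * (u * log (q y) - log (Z u)) = u * (Z1 u / Z u) - log (Z u) := by
      calc _ = ∑ y, (u * (τ y * log (q y)) - log (Z u) * τ y) :=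
            sum_congr rfl fun y _ => by ring
        _ = _ := by rw [sum_sub_distrib, ← mul_sum, ← mul_sum, hτs, e1, mul_one]
    rw [k3, k4] at key
    linarith
  -- Concave because `(log Z)'' ≤ N / u ^ 2`; the claim is its tangent line at `u = 1`.
  set H : ℝ → ℝ := fun u => log (Z u) + N * log u with hH
  have dH : ∀ u, 0 < u → HasDerivAt H (Z1 u / Z u + N * u⁻¹) u := fun u hu =>
    ((dZ u).log (hZpos u).ne').add ((hasDerivAt_log hu.ne').const_mul N)
  have dH1 : ∀ u, 0 < u → HasDerivAt (fun u => Z1 u / Z u + N * u⁻¹)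
      ((Z2 u * Z u - Z1 u * Z1 u) / Z u ^ 2 + N * (-(u ^ 2)⁻¹)) u := fun u hu =>
    ((dZ1 u).div (dZ u) (hZpos u).ne').add ((hasDerivAt_inv hu.ne').const_mul N)
  have hconc : ConcaveOn ℝ (Set.Ioi 0) H := by
    refine concaveOn_of_hasDerivWithinAt2_nonpos (convex_Ioi 0)
      (fun x hx => (dH x hx).continuousAt.continuousWithinAt)
      (f' := fun u => Z1 u / Z u + N * u⁻¹)
      (f'' := fun u => (Z2 u * Z u - Z1 u * Z1 u) / Z u ^ 2 + N * (-(u ^ 2)⁻¹)) ?_ ?_ ?_ <;>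
      rw [interior_Ioi]
    · exact fun x hx => (dH x hx).hasDerivWithinAt
    · exact fun x hx => (dH1 x hx).hasDerivWithinAt
    · intro x hx
      have hx2 : 0 < x ^ 2 := pow_pos hx 2
      have hz := hZpos x
      have e : (Z2 x * Z x - Z1 x * Z1 x) / Z x ^ 2 = Z2 x / Z x - (Z1 x / Z x) ^ 2 := by
        field_simp
      have := (le_div_iff₀' hx2).2 (hvar x)
      rw [e]
      rw [div_eq_mul_inv N] at this
      linarith
  have hZ1one : Z 1 = 1 := by simp [hZ, hq.2]
  have hone : Z1 1 = ∑ y, q y * log (q y) := by simp [hZ1]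
  have hH1 : H 1 = 0 := by simp [hH, hZ1one]
  have hd := dH 1 one_pos
  rw [hZ1one, hone, div_one, inv_one, mul_one] at hd
  have tangent : H u ≤ (∑ y, q y * log (q y) + N) * (u - 1) := by
    rcases lt_trichotomy u 1 with h | h | h
    · have := hconc.le_slope_of_hasDerivAt (x := u) (y := 1) hu (Set.mem_Ioi.2 one_pos) h hd
      rw [slope_def_field, hH1, le_div_iff₀ (by linarith)] at this
      linarith
    · simp [h, hH1]
    · have := hconc.slope_le_of_hasDerivAt (x := 1) (y := u) (Set.mem_Ioi.2 one_pos) hu h hd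
      rw [slope_def_field, hH1, div_le_iff₀ (by linarith)] at this
      linarith
  have : H u = log (Z u) + N * log u := rfl
  change log (Z u) ≤ _
  linarith

open Real Finset in
/-- Gibbs' inequality against an unnormalized positive weight `q * exp g`. -/
theorem DMC.gibbs {Y : Type*} [Fintype Y] (p q g : Y → ℝ) (hp : p ∈ stdSimplex ℝ Y)
    (hq : ∀ y, 0 ≤ q y) (hpq : ∀ y, q y = 0 → p y = 0) :
    ∑ y, p y * (log (q y) + g y) - log (∑ y, q y * exp (g y)) ≤ ∑ y, p y * log (p y) := by
  set Z := ∑ y, q y * exp (g y) with hZ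
  have hZpos : 0 < Z := by
    obtain ⟨i, hi⟩ : ∃ i, 0 < p i := by
      by_contra! hcon
      have : ∑ y, p y ≤ 0 := sum_nonpos fun y _ => hcon y
      linarith [hp.2]
    have hqi : 0 < q i := (hq i).lt_of_ne fun h => hi.ne' (hpq i h.symm)
    exact sum_pos' (fun y _ => mul_nonneg (hq y) (exp_pos _).le)
      ⟨i, mem_univ _, mul_pos hqi (exp_pos _)⟩
  have hterm : ∀ y, p y * (log (q y) + g y) - log Z * p y - p y * log (p y)
      ≤ q y * exp (g y) / Z - p y := by
    intro y
    rcases (hp.1 y).eq_or_lt with h | h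
    · rw [← h]
      simpa using div_nonneg (mul_nonneg (hq y) (exp_pos (g y)).le) hZpos.le
    · have hqy : 0 < q y := (hq y).lt_of_ne fun h' => h.ne' (hpq y h'.symm)
      have h1 := log_le_sub_one_of_pos
        (show 0 < q y * exp (g y) / Z / p y by positivity)
      rw [log_div (by positivity) h.ne', log_div (by positivity) hZpos.ne',
        log_mul hqy.ne' (exp_pos _).ne', log_exp] at h1
      have h2 := mul_le_mul_of_nonneg_left h1 h.le
      have h3 : p y * (q y * exp (g y) / Z / p y - 1) = q y * exp (g y) / Z - p y := by
        field_simp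
      linarith
  have := sum_le_sum fun y (_ : y ∈ univ) => hterm y
  simp only [sum_sub_distrib] at this
  rw [← sum_div, ← hZ, div_self hZpos.ne', hp.2, ← mul_sum, hp.2] at this
  linarith

open Real Finset in
/-- Lower bound on the relative entropy of `p` to `q` by the entropy difference `δ`. -/
theorem DMC.relEntropy_ge {Y : Type*} [Fintype Y] (p q : Y → ℝ) (hp : p ∈ stdSimplex ℝ Y)
    (hq : q ∈ stdSimplex ℝ Y) (hpq : ∀ y, q y = 0 → p y = 0) (N : ℝ) (hN0 : 0 < N)
    (hN : ∀ p ∈ stdSimplex ℝ Y, DMC.surprisalVariance p ≤ N) (δ : ℝ)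
    (hδ : δ = ∑ y, q y * log (q y) - ∑ y, p y * log (p y)) :
    N * (exp (δ / N) - 1 - δ / N) ≤ ∑ y, p y * log (p y) - ∑ y, p y * log (q y) := by
  -- The tilt that optimizes the resulting lower bound.
  set u := exp (-(δ / N)) with hu
  have hupos : 0 < u := exp_pos _
  have h1 := DMC.log_partition_le q hq N hN u hupos
  have h2 := DMC.gibbs p q (fun y => (u - 1) * log (q y)) hp hq.1 hpq
  have h3 : ∑ y, p y * (log (q y) + (u - 1) * log (q y)) = u * ∑ y, p y * log (q y) := by
    rw [mul_sum]; exact sum_congr rfl fun y _ => by ring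
  have h4 : N * log u = -δ := by rw [hu, log_exp]; field_simp
  have h5 : exp (δ / N) = u⁻¹ := by rw [hu, ← exp_neg, neg_neg]
  rw [h3] at h2
  set A := ∑ y, p y * log (q y)
  set B := ∑ y, p y * log (p y)
  set S := ∑ y, q y * log (q y)
  rw [h5]
  have h6 : N * (u⁻¹ - 1 - δ / N) = (N * (1 - u) - u * δ) / u := by field_simp
  rw [h6, div_le_iff₀ hupos]
  have h7 : S = B + δ := by linarith
  rw [h7] at h1
  linarith

/-! ### Cubic estimates of the exponential -/

-- Integrate `exp (-y) ≥ 1 - y` twice from `0`.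
open Real in
theorem DMC.exp_ge_cubic {x : ℝ} (hx : 0 ≤ x) :
    x ^ 2 / 2 - x ^ 3 / 6 ≤ exp (-x) - 1 + x := by
  have e : ∀ y, HasDerivAt (fun y => exp (-y)) (-exp (-y)) y := fun y => by
    simpa using (hasDerivAt_neg y).exp
  have mono2 : MonotoneOn (fun y : ℝ => 1 - y + y ^ 2 / 2 - exp (-y)) (Set.Ici 0) := by
    have hd : ∀ y : ℝ, HasDerivAt (fun y : ℝ => 1 - y + y ^ 2 / 2 - exp (-y))
        (-1 + y + exp (-y)) y := fun y => by
      refine ((((hasDerivAt_id y).const_sub 1).add ((hasDerivAt_pow 2 y).div_const 2)).sub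
        (e y)).congr_deriv ?_
      simp
    refine monotoneOn_of_deriv_nonneg (convex_Ici 0)
      (fun y _ => (hd y).continuousAt.continuousWithinAt)
      (fun y _ => (hd y).differentiableAt.differentiableWithinAt) fun y _ => ?_
    rw [(hd y).deriv]
    linarith [add_one_le_exp (-y)]
  have mono3 : MonotoneOn (fun y : ℝ => exp (-y) - 1 + y - y ^ 2 / 2 + y ^ 3 / 6)
      (Set.Ici 0) := by
    have hd : ∀ y : ℝ, HasDerivAt (fun y : ℝ => exp (-y) - 1 + y - y ^ 2 / 2 + y ^ 3 / 6)
        (-exp (-y) + 1 - y + y ^ 2 / 2) y := fun y => by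
      refine (((((e y).sub_const 1).add (hasDerivAt_id y)).sub
        ((hasDerivAt_pow 2 y).div_const 2)).add ((hasDerivAt_pow 3 y).div_const 6)).congr_deriv ?_
      simp
      ring
    refine monotoneOn_of_deriv_nonneg (convex_Ici 0)
      (fun y _ => (hd y).continuousAt.continuousWithinAt)
      (fun y _ => (hd y).differentiableAt.differentiableWithinAt) fun y hy => ?_
    rw [(hd y).deriv]
    have := mono2 Set.self_mem_Ici (interior_subset hy) (Set.mem_Ici.1 (interior_subset hy))
    norm_num at this
    linarith
  have := mono3 Set.self_mem_Ici hx hx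
  norm_num at this
  linarith

open Real in
/-- `exp x - 1 - x` is smallest, among `|x| ≥ t`, at `x = -t`. -/
theorem DMC.exp_sub_ge_of_le_abs {x t : ℝ} (ht : 0 ≤ t) (hx : t ≤ |x|) :
    t ^ 2 / 2 - t ^ 3 / 6 ≤ exp x - 1 - x := by
  rcases le_total 0 x with h | h
  · rw [abs_of_nonneg h] at hx
    have := quadratic_le_exp_of_nonneg h
    have h2 : t ^ 2 ≤ x ^ 2 := by gcongr
    have h3 : 0 ≤ t ^ 3 := by positivity
    linarith
  · rw [abs_of_nonpos h] at hx
    have h1 := DMC.exp_ge_cubic ht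
    -- Tangent at `-t`: since `x + t ≤ 0` and `exp (-t) ≤ 1`, its slope may be replaced by `1`.
    have h2 : exp x = exp (-t) * exp (x + t) := by rw [← exp_add]; ring_nf
    have h3 := add_one_le_exp (x + t)
    have h4 : exp (-t) ≤ 1 := exp_le_one_iff.2 (by linarith)
    have h5 := mul_le_mul_of_nonneg_left h3 (exp_pos (-t)).le
    nlinarith
-- The equidistant mixture
open Real Finset in
/-- Some nontrivial mixture of two distributions has the same relative entropy from both. -/
theorem DMC.exists_mixture_relEntropy_eq {Y : Type*} [Fintype Y] (ρ σ : Y → ℝ)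
    (hρ : ρ ∈ stdSimplex ℝ Y) (hσ : σ ∈ stdSimplex ℝ Y) :
    ∃ w ∈ Set.Ioo (0 : ℝ) 1,
      ∑ y, ρ y * log (ρ y) - ∑ y, ρ y * log (w * ρ y + (1 - w) * σ y) =
        ∑ y, σ y * log (σ y) - ∑ y, σ y * log (w * ρ y + (1 - w) * σ y) := by
  set R := ∑ y, ρ y * log (ρ y) with hR
  set S := ∑ y, σ y * log (σ y) with hS
  -- The mutual information of the input with weights `w`, `1 - w`; its derivative is the difference
  -- of the two relative entropies.
  set F : ℝ → ℝ := fun w => w * R + (1 - w) * S -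
    ∑ y, (w * ρ y + (1 - w) * σ y) * log (w * ρ y + (1 - w) * σ y) with hF
  have hzero : ∀ w ∈ Set.Ioo (0 : ℝ) 1, ∀ y, w * ρ y + (1 - w) * σ y = 0 → ρ y = 0 ∧ σ y = 0 := by
    intro w hw y h
    have h1 : 0 < 1 - w := by linarith [hw.2]
    have := (add_eq_zero_iff_of_nonneg (mul_nonneg hw.1.le (hρ.1 y))
      (mul_nonneg h1.le (hσ.1 y))).1 h
    exact ⟨(mul_eq_zero.1 this.1).resolve_left hw.1.ne', (mul_eq_zero.1 this.2).resolve_left h1.ne'⟩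
  have hcont : Continuous F := by
    refine Continuous.sub (by fun_prop) (continuous_finsetSum _ fun y _ => ?_)
    exact continuous_mul_log.comp (by fun_prop)
  have hF0 : F 0 = 0 := by simp [hF, hS]
  have hF1 : F 1 = 0 := by simp [hF, hR]
  have hFhalf : 0 ≤ F (1 / 2) := by
    have hw : (1 / 2 : ℝ) ∈ Set.Ioo (0 : ℝ) 1 := by norm_num
    have hq : ∀ y, 0 ≤ 1 / 2 * ρ y + (1 - 1 / 2) * σ y := fun y => by
      have := hρ.1 y; have := hσ.1 y; linarith
    have hqs : ∑ y, (1 / 2 * ρ y + (1 - 1 / 2) * σ y) = 1 := by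
      rw [sum_add_distrib, ← mul_sum, ← mul_sum, hρ.2, hσ.2]; norm_num
    have g1 := DMC.gibbs ρ (fun y => 1 / 2 * ρ y + (1 - 1 / 2) * σ y) (fun _ => 0) hρ hq
      fun y h => (hzero _ hw y h).1
    have g2 := DMC.gibbs σ (fun y => 1 / 2 * ρ y + (1 - 1 / 2) * σ y) (fun _ => 0) hσ hq
      fun y h => (hzero _ hw y h).2
    simp only [exp_zero, mul_one, hqs, log_one, sub_zero, add_zero] at g1 g2
    simp only [hF, add_mul, sum_add_distrib, mul_assoc, ← mul_sum]
    linarith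
  obtain ⟨v, hv, hvmax⟩ := isCompact_Icc.exists_isMaxOn (s := Set.Icc (0 : ℝ) 1)
    ⟨0, by norm_num⟩ hcont.continuousOn
  -- `F` vanishes at both endpoints and `F (1 / 2) ≥ 0`, so if an endpoint is maximal, so is `1 /
  -- 2`.
  obtain ⟨w, hw, hwmax⟩ : ∃ w ∈ Set.Ioo (0 : ℝ) 1, IsMaxOn F (Set.Icc 0 1) w := by
    by_cases h : v ∈ Set.Ioo (0 : ℝ) 1
    · exact ⟨v, h, hvmax⟩
    · refine ⟨1 / 2, by norm_num, fun x hx => (show F x ≤ F v from hvmax hx).trans ?_⟩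
      have : v = 0 ∨ v = 1 := by
        by_contra! hcon
        exact h ⟨hv.1.lt_of_ne hcon.1.symm, hv.2.lt_of_ne hcon.2⟩
      rcases this with rfl | rfl
      · rwa [hF0]
      · rwa [hF1]
  refine ⟨w, hw, ?_⟩
  have hlin : ∀ y, HasDerivAt (fun t : ℝ => t * ρ y + (1 - t) * σ y) (ρ y - σ y) w := fun y =>
    (((hasDerivAt_id w).mul_const (ρ y)).add
      (((hasDerivAt_id w).const_sub 1).mul_const (σ y))).congr_deriv (by ring)
  have hterm : ∀ y, HasDerivAt
      (fun t : ℝ => (t * ρ y + (1 - t) * σ y) * log (t * ρ y + (1 - t) * σ y))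
      ((ρ y - σ y) * (log (w * ρ y + (1 - w) * σ y) + 1)) w := by
    intro y
    by_cases h : w * ρ y + (1 - w) * σ y = 0
    · obtain ⟨h1, h2⟩ := hzero w hw y h
      simp only [h1, h2, mul_zero, add_zero, zero_mul, sub_zero]
      exact hasDerivAt_const _ _
    · refine ((hlin y).fun_mul ((hlin y).log h)).congr_deriv ?_
      rw [mul_div_cancel₀ _ h]
      ring
  have hder : HasDerivAt F
      (R - S - ∑ y, (ρ y - σ y) * (log (w * ρ y + (1 - w) * σ y) + 1)) w := by
    refine ((((hasDerivAt_id w).mul_const R).add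
      (((hasDerivAt_id w).const_sub 1).mul_const S)).sub
      (HasDerivAt.fun_sum (u := univ) fun y _ => hterm y)).congr_deriv ?_
    ring
  have h0 := (hwmax.isLocalMax (Icc_mem_nhds hw.1 hw.2)).hasDerivAt_eq_zero hder
  simp only [mul_add (_ - _), sub_mul (ρ _), mul_one, sum_add_distrib, sum_sub_distrib, hρ.2,
    hσ.2] at h0
  linarith

open Real Finset in
/-- The Jensen–Shannon type lower bound for the capacity of a channel with two inputs. -/
theorem DMC.exists_mixture_relEntropy_ge {Y : Type*} [Fintype Y] (ρ σ : Y → ℝ)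
    (hρ : ρ ∈ stdSimplex ℝ Y) (hσ : σ ∈ stdSimplex ℝ Y) (N : ℝ) (hN0 : 0 < N)
    (hN : ∀ p ∈ stdSimplex ℝ Y, DMC.surprisalVariance p ≤ N) (Δ : ℝ)
    (hΔ : Δ = |∑ y, ρ y * log (ρ y) - ∑ y, σ y * log (σ y)|) :
    ∃ w ∈ Set.Ioo (0 : ℝ) 1, Δ ^ 2 / (8 * N) - Δ ^ 3 / (48 * N ^ 2) ≤
      w * (∑ y, ρ y * log (ρ y) - ∑ y, ρ y * log (w * ρ y + (1 - w) * σ y)) +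
      (1 - w) * (∑ y, σ y * log (σ y) - ∑ y, σ y * log (w * ρ y + (1 - w) * σ y)) := by
  obtain ⟨w, hw, heq⟩ := DMC.exists_mixture_relEntropy_eq ρ σ hρ hσ
  refine ⟨w, hw, ?_⟩
  have h1 : 0 < 1 - w := by linarith [hw.2]
  have hΔ0 : 0 ≤ Δ := hΔ ▸ abs_nonneg _
  set q : Y → ℝ := fun y => w * ρ y + (1 - w) * σ y with hq
  have hqmem : q ∈ stdSimplex ℝ Y := by
    refine ⟨fun y => add_nonneg (mul_nonneg hw.1.le (hρ.1 y)) (mul_nonneg h1.le (hσ.1 y)), ?_⟩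
    rw [hq, sum_add_distrib, ← mul_sum, ← mul_sum, hρ.2, hσ.2]; ring
  have hzero : ∀ y, q y = 0 → ρ y = 0 ∧ σ y = 0 := by
    intro y h
    have := (add_eq_zero_iff_of_nonneg (mul_nonneg hw.1.le (hρ.1 y))
      (mul_nonneg h1.le (hσ.1 y))).1 h
    exact ⟨(mul_eq_zero.1 this.1).resolve_left hw.1.ne', (mul_eq_zero.1 this.2).resolve_left h1.ne'⟩
  have key : ∀ p ∈ stdSimplex ℝ Y, (∀ y, q y = 0 → p y = 0) →
      Δ / 2 ≤ |∑ y, q y * log (q y) - ∑ y, p y * log (p y)| →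
      Δ ^ 2 / (8 * N) - Δ ^ 3 / (48 * N ^ 2) ≤
        ∑ y, p y * log (p y) - ∑ y, p y * log (q y) := by
    intro p hp hpq hd
    refine le_trans ?_ (DMC.relEntropy_ge p q hp hqmem hpq N hN0 hN _ rfl)
    have h2 : Δ / 2 / N ≤ |(∑ y, q y * log (q y) - ∑ y, p y * log (p y)) / N| := by
      rw [abs_div, abs_of_pos hN0]; gcongr
    -- With `t = Δ / (2 * N)`, `N * (t ^ 2 / 2 - t ^ 3 / 6)` is the stated bound.
    have h3 := mul_le_mul_of_nonneg_left (DMC.exp_sub_ge_of_le_abs (by positivity) h2) hN0.le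
    refine le_trans (le_of_eq ?_) h3
    field_simp
    ring
  have hor : Δ / 2 ≤ |∑ y, q y * log (q y) - ∑ y, ρ y * log (ρ y)| ∨
      Δ / 2 ≤ |∑ y, q y * log (q y) - ∑ y, σ y * log (σ y)| := by
    by_contra! hcon
    have := abs_sub_le (∑ y, ρ y * log (ρ y)) (∑ y, q y * log (q y)) (∑ y, σ y * log (σ y))
    rw [abs_sub_comm (∑ y, ρ y * log (ρ y)) (∑ y, q y * log (q y))] at this
    linarith
  rw [heq, ← add_mul, add_sub_cancel, one_mul]
  rcases hor with h | h
  · exact heq ▸ key ρ hρ (fun y hy => (hzero y hy).1) h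
  · exact key σ hσ (fun y hy => (hzero y hy).2) h

/-! ### Two-point inputs and the capacity -/

/-- The input distribution with weight `w` at `a` and `1 - w` at `b`. -/
noncomputable def DMC.twoPoint {X : Type*} (a b : X) (w : ℝ) (hw : w ∈ Set.Ioo (0 : ℝ) 1) : PMF X :=
  ⟨fun x => ENNReal.ofReal w * PMF.pure a x + ENNReal.ofReal (1 - w) * PMF.pure b x, by
    have h : ∀ (c : ENNReal) (a : X), HasSum (fun x => c * PMF.pure a x) c := fun c a => by
      have := ENNReal.summable (f := fun x => c * PMF.pure a x).hasSum
      rwa [ENNReal.tsum_mul_left, PMF.tsum_coe, mul_one] at this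
    have := (h (ENNReal.ofReal w) a).add (h (ENNReal.ofReal (1 - w)) b)
    rwa [← ENNReal.ofReal_add hw.1.le (by linarith [hw.2]), add_sub_cancel,
      ENNReal.ofReal_one] at this⟩

theorem DMC.hasSum_twoPoint {X : Type*} (a b : X) (w : ℝ) (hw : w ∈ Set.Ioo (0 : ℝ) 1)
    (g : X → ℝ) :
    HasSum (fun x => (DMC.twoPoint a b w hw x).toReal * g x) (w * g a + (1 - w) * g b) := by
  classical
  have h1 : 0 ≤ 1 - w := by linarith [hw.2]
  have h : ∀ (c : ℝ) (a : X), HasSum (fun x => if x = a then c * g a else 0) (c * g a) :=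
    fun c a => hasSum_ite_eq a _
  convert (h w a).add (h (1 - w) b) using 2 with x
  have e : DMC.twoPoint a b w hw x =
    ENNReal.ofReal w * PMF.pure a x + ENNReal.ofReal (1 - w) * PMF.pure b x := rfl
  rw [e, PMF.pure_apply, PMF.pure_apply]
  by_cases ha : x = a <;> by_cases hb : x = b
  · subst ha; subst hb
    simp [ENNReal.toReal_add, ENNReal.toReal_ofReal hw.1.le, ENNReal.toReal_ofReal h1]
    ring
  · subst ha; simp [hb, ENNReal.toReal_ofReal hw.1.le]
  · subst hb; simp [ha, ENNReal.toReal_ofReal h1]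
  · simp [ha, hb]

open Real Finset in
theorem DMC.mutualInfo_twoPoint {X Y : Type*} [Fintype Y] (T : X → PMF Y) (a b : X) (w : ℝ)
    (hw : w ∈ Set.Ioo (0 : ℝ) 1) :
    DMC.mutualInfo T (DMC.twoPoint a b w hw) =
      w * (∑ y, (T a y).toReal * log (T a y).toReal -
        ∑ y, (T a y).toReal * log (w * (T a y).toReal + (1 - w) * (T b y).toReal)) +
      (1 - w) * (∑ y, (T b y).toReal * log (T b y).toReal -
        ∑ y, (T b y).toReal * log (w * (T a y).toReal + (1 - w) * (T b y).toReal)) := by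
  have h1 : 0 < 1 - w := by linarith [hw.2]
  have hbind : ∀ y, ((DMC.twoPoint a b w hw).bind T y).toReal =
      w * (T a y).toReal + (1 - w) * (T b y).toReal := fun y =>
    (DMC.hasSum_bind T _ y).unique (DMC.hasSum_twoPoint a b w hw fun x => (T x y).toReal)
  have hpos : ∀ x y, 0 ≤ (T x y).toReal := fun x y => ENNReal.toReal_nonneg
  unfold DMC.mutualInfo
  simp only [hbind, mul_assoc, ← mul_sum]
  rw [(DMC.hasSum_twoPoint a b w hw _).tsum_eq, ← sum_sub_distrib, ← sum_sub_distrib]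
  congr 2 <;> refine sum_congr rfl fun y _ => ?_
  · rcases (hpos a y).eq_or_lt with h | h
    · simp [← h]
    · have := mul_pos hw.1 h
      have := mul_nonneg h1.le (hpos b y)
      rw [log_div h.ne' (by linarith)]; ring
  · rcases (hpos b y).eq_or_lt with h | h
    · simp [← h]
    · have := mul_pos h1 h
      have := mul_nonneg hw.1.le (hpos a y)
      rw [log_div h.ne' (by linarith)]; ring

open Real Finset in
theorem DMC.capacity_ge_of_pair {X Y : Type*} [Fintype Y] (T : X → PMF Y) (a b : X) :
    |DMC.entropy (T a) - DMC.entropy (T b)| ^ 2 /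
          (2 * (log ((Fintype.card Y : ℝ) - 1) ^ 2 + 4)) -
        |DMC.entropy (T a) - DMC.entropy (T b)| ^ 3 /
          (3 * (log ((Fintype.card Y : ℝ) - 1) ^ 2 + 4) ^ 2) ≤ DMC.capacity T := by
  have hmem : ∀ x, (fun y => (T x y).toReal) ∈ stdSimplex ℝ Y := fun x =>
    ⟨fun y => ENNReal.toReal_nonneg, DMC.sum_toReal (T x)⟩
  set N := 1 + log ((Fintype.card Y : ℝ) - 1) ^ 2 / 4 with hN
  obtain ⟨w, hw, h⟩ := DMC.exists_mixture_relEntropy_ge _ _ (hmem a) (hmem b) N (by positivity)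
    DMC.surprisalVariance_le _ rfl
  have habs : |DMC.entropy (T a) - DMC.entropy (T b)| =
      |∑ y, (T a y).toReal * log (T a y).toReal - ∑ y, (T b y).toReal * log (T b y).toReal| := by
    rw [abs_sub_comm]; unfold DMC.entropy; congr 1; ring
  have hL : log ((Fintype.card Y : ℝ) - 1) ^ 2 + 4 = 4 * N := by rw [hN]; ring
  rw [habs, hL]
  refine le_trans (le_of_eq ?_)
    (h.trans ((DMC.mutualInfo_twoPoint T a b w hw).symm.le.trans
      (le_ciSup (DMC.bddAbove_mutualInfo T) _)))
  ring_nf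

-- The extremal entropies need not be attained; the pairwise bound is continuous in the gap and
-- passes to the limit along approximating columns.
open Filter Topology in
theorem mainTheorem4 {X Y : Type*} [Nonempty X] [Fintype Y] (hY : 2 ≤ Fintype.card Y)
    (T : X → PMF Y) :
    DMC.capacity T ≥
      (DMC.maxEntropy T - DMC.minEntropy T) ^ 2 /
          (2 * (Real.log ((Fintype.card Y : ℝ) - 1) ^ 2 + 4)) -
        (DMC.maxEntropy T - DMC.minEntropy T) ^ 3 /
          (3 * (Real.log ((Fintype.card Y : ℝ) - 1) ^ 2 + 4) ^ 2) := by
  have hne := Set.range_nonempty fun x => DMC.entropy (T x)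
  obtain ⟨u, -, hu, hu'⟩ := exists_seq_tendsto_sSup hne (DMC.bddAbove_entropy T)
  obtain ⟨v, -, hv, hv'⟩ := exists_seq_tendsto_sInf hne (DMC.bddBelow_entropy T)
  have hle : DMC.minEntropy T ≤ DMC.maxEntropy T := by
    let x : X := Classical.arbitrary X
    exact (ciInf_le (DMC.bddBelow_entropy T) x).trans (le_ciSup (DMC.bddAbove_entropy T) x)
  have hlim : Tendsto (fun n => |u n - v n|) atTop
      (𝓝 (DMC.maxEntropy T - DMC.minEntropy T)) := by
    have := (hu.sub hv).abs
    rw [← abs_of_nonneg (sub_nonneg.2 hle)]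
    exact this
  refine ge_iff_le.2 (le_of_tendsto (((hlim.pow 2).div_const _).sub ((hlim.pow 3).div_const _))
    (Eventually.of_forall fun n => ?_))
  obtain ⟨a, ha⟩ := hu' n
  obtain ⟨b, hb⟩ := hv' n
  rw [← ha, ← hb]
  exact DMC.capacity_ge_of_pair T a b
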